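/- Let $R$ be a commutative ring with identity having a unique maximal ideal $\mathfrak m$ (a quasi-local ring; $R$ is not assumed Noetherian). Let $M$ be a nonzero $R$-module of finite projective dimension that is $(FP)_\infty$, i.e. for every $n\ge 0$ there is an exact sequence $F_n\to F_{n-1}\to\cdots\to F_1\to F_0\to M\to 0$ with $F_0,\dots,F_n$ finitely generated free $R$-modules. For a nonzero finitely generated $R$-module $N$, let $\operatorname{depth} N\in\{0,1,2,\dots\}\cup\{\infty\}$ denote the supremum, over all faithfully flat commutative $R$-algebras $S$, of the lengths of the regular sequences on $N\otimes_R S$ whose terms lie in $\mathfrak m S$. Then $$\operatorname{depth} M+\operatorname{pd}_R M=\operatorname{depth} R,$$ where both sides may be $\infty$. -/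

import Mathlib

open scoped TensorProduct

universe u v

namespace NonNoetherian

/-- `M` is `(FP)_n`: there is an exact sequence `F_n → F_{n-1} → ⋯ → F_1 → F_0 → M → 0` in which
`F_0, …, F_n` are finitely generated free modules, written here as `F_i = R ^ (r i)`.
The map `F_{i+1} → F_i` is `d i`; the data of index beyond `n` carry no condition. -/
def IsFP (R : Type u) [CommRing R] (M : Type v) [AddCommGroup M] [Module R M] (n : ℕ) : Prop :=
  ∃ (r : ℕ → ℕ) (d : (i : ℕ) → (Fin (r (i + 1)) → R) →ₗ[R] (Fin (r i) → R))
    (ε : (Fin (r 0) → R) →ₗ[R] M),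
    Function.Surjective ε ∧ (0 < n → Function.Exact (d 0) ε) ∧
      ∀ i : ℕ, i + 1 < n → Function.Exact (d (i + 1)) (d i)

/-- `M` is `(FP)_∞`: it is `(FP)_n` for every `n`. -/
def IsFPInfinity (R : Type u) [CommRing R] (M : Type v) [AddCommGroup M] [Module R M] : Prop :=
  ∀ n : ℕ, IsFP R M n

/-- The classical depth `Depth_I M` (meaningful when `I M ≠ M`): the supremum in `ℕ ∪ {∞}` of the
lengths of the regular sequences on `M` whose terms lie in `I`. -/
noncomputable def classicalDepth {R : Type u} [CommRing R] (I : Ideal R)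
    (M : Type v) [AddCommGroup M] [Module R M] : ℕ∞ :=
  ⨆ (rs : List R) (_ : ∀ x ∈ rs, x ∈ I) (_ : RingTheory.Sequence.IsRegular M rs),
    (rs.length : ℕ∞)

/-- The (Barger–Hochster–Northcott) depth `depth_I M` (meaningful when `I M ≠ M`): the supremum of
`Depth_{IS} (M ⊗_R S)` over all commutative faithfully flat `R`-algebras `S`. The algebras range
over the universe of `R`; larger universes give the same value, as the supremum is already that
over the polynomial rings `R[X_1, …, X_n]`. -/
noncomputable def idealDepth {R : Type u} [CommRing R] (I : Ideal R)
    (M : Type v) [AddCommGroup M] [Module R M] : ℕ∞ :=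
  ⨆ (S : Type u) (_ : CommRing S) (_ : Algebra R S) (_ : Module.FaithfullyFlat R S),
    classicalDepth (I.map (algebraMap R S)) (S ⊗[R] M)

/-- The depth of a module over a quasi-local ring: its depth with respect to the maximal ideal. -/
noncomputable def depth (R : Type u) [CommRing R] [IsLocalRing R]
    (M : Type v) [AddCommGroup M] [Module R M] : ℕ∞ :=
  idealDepth (IsLocalRing.maximalIdeal R) M

end NonNoetherian

-- Let `Q = R[X]/(f)`, where the content ideal of `f` is a finitely generated ideal `J ⊆ 𝔪`. By
-- McCoy's theorem `f` is regular on `N[X]` as soon as no nonzero element of `N` is killed by `J`.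
-- Iterating `N ↦ Q ⊗ N = N[X]/f N[X]` therefore tests the sequence `f(X₁), f(X₂), …`, and
-- `PolyDepthGE` serves as depth in `J` without Ext or Koszul homology. The usual depth lemmas for
-- short exact sequences follow by induction. `exists_isWeaklyRegular`, `of_isWeaklyRegular` and
-- `of_tensorProduct` pass between this notion and regular sequences over faithfully flat algebras,
-- so the bound depends only on `J` and is monotone in it; `le_depth_iff` recovers `depth`. The
-- formula is proved by induction on the projective dimension, for all `J` above some finitely
-- generated ideal. Dimension 0 is the free case. In dimension 1 a minimal cover has its kernel
-- inside `𝔪 F`, and the inclusion, having coefficients in `J`, forces the drop by one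
-- (`iff_of_exact_of_mem_smul`). From dimension 2 on, the depth lemmas for an arbitrary finite free
-- cover suffice (`iff_of_exact`).

universe w w'

namespace NonNoetherian

open Polynomial

/-! ### McCoy's theorem for polynomial modules -/

section CoeffTorsionFree

variable {R : Type u} [CommRing R] (f : R[X])

/-- No nonzero element of `N` is annihilated by all the coefficients of `f`. -/
def CoeffTorsionFree (N : Type v) [AddCommGroup N] [Module R N] : Prop :=
  ∀ n : N, (∀ i, f.coeff i • n = 0) → n = 0

variable {f}

theorem CoeffTorsionFree.of_injective {N : Type v} [AddCommGroup N] [Module R N]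
    {P : Type w} [AddCommGroup P] [Module R P] (hP : CoeffTorsionFree f P)
    (φ : N →ₗ[R] P) (hφ : Function.Injective φ) : CoeffTorsionFree f N := by
  intro n hn
  refine hφ ?_
  rw [map_zero]
  exact hP _ fun i => by rw [← map_smul, hn i, map_zero]

/-- McCoy's theorem for modules. -/
theorem CoeffTorsionFree.eq_zero_of_smul_eq_zero {N : Type v} [AddCommGroup N] [Module R N]
    (hN : CoeffTorsionFree f N) (g : PolynomialModule R N) (hg : f • g = 0) : g = 0 := by
  suffices H : ∀ (n : ℕ) (g : PolynomialModule R N), (∀ j, n ≤ j → g.coeff j = 0) →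
      f • g = 0 → g = 0 by
    refine H (g.coeff.support.sup id + 1) g (fun j hj => ?_) hg
    by_contra h
    have := Finset.le_sup (f := id) (Finsupp.mem_support_iff.mpr h)
    simp only [id] at this
    omega
  intro n
  induction n with
  | zero =>
    intro g hg _
    rw [← PolynomialModule.coeff_eq_zero]
    ext j
    simpa using hg j (Nat.zero_le j)
  | succ n ih =>
    intro g hg hfg
    -- Descending induction on `i`: once the higher coefficients of `f` kill `g`, degree `i + n` of
    -- `f • g = 0` reads `fᵢ gₙ = 0`. So `fᵢ • g` is shorter than `g` and still killed by `f`, and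
    -- the outer induction applies.
    have key : ∀ d i, f.natDegree < i + d → f.coeff i • g = 0 := by
      intro d
      induction d with
      | zero => intro i hi; rw [coeff_eq_zero_of_natDegree_lt (by simpa using hi), zero_smul]
      | succ d ihd =>
        intro i hi
        have hlt : ∀ a, i < a → f.coeff a • g = 0 := fun a ha => ihd a (by omega)
        have hcoeff : ∀ (r : R) (g : PolynomialModule R N) (j : ℕ),
          (r • g).coeff j = r • g.coeff j := fun _ _ _ => rfl
        have htop : f.coeff i • g.coeff n = 0 := by
          have h0 : (f • g).coeff (i + n) = 0 := by rw [hfg]; rfl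
          rw [PolynomialModule.smul_apply, Finset.sum_eq_single (i, n)] at h0
          · exact h0
          · rintro ⟨a, b⟩ hab hne
            rw [Finset.HasAntidiagonal.mem_antidiagonal] at hab
            dsimp only at hab ⊢
            rcases lt_trichotomy a i with h | h | h
            · rw [hg b (by omega), smul_zero]
            · exact absurd (Prod.ext h (by dsimp only; omega)) hne
            · rw [← hcoeff, hlt a h]; rfl
          · intro h
            exact absurd (by rw [Finset.HasAntidiagonal.mem_antidiagonal]) h
        refine ih _ (fun j hj => ?_) ?_
        · rw [hcoeff]
          rcases hj.eq_or_lt with rfl | hj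
          · exact htop
          · rw [hg j hj, smul_zero]
        · rw [smul_comm, hfg, smul_zero]
    rw [← PolynomialModule.coeff_eq_zero]
    ext j
    refine hN _ fun i => ?_
    have := key (f.natDegree + 1) i (by omega)
    exact congrArg (fun g : PolynomialModule R N => g.coeff j) this

theorem CoeffTorsionFree.isSMulRegular {N : Type v} [AddCommGroup N] [Module R N]
    (hN : CoeffTorsionFree f N) : IsSMulRegular (R[X] ⊗[R] N) f := by
  intro x y hxy
  let e := PolynomialModule.polynomialTensorProductLEquivPolynomialModule R N
  have hxy : f • x = f • y := hxy
  refine sub_eq_zero.mp (e.injective ?_)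
  rw [map_zero]
  exact hN.eq_zero_of_smul_eq_zero _ (by rw [← map_smul, smul_sub, hxy, sub_self, map_zero])

end CoeffTorsionFree

/-! ### Reduction modulo a generic element -/

section Quotient

variable {R : Type u} [CommRing R] (f : R[X])

/-- The quotient `R[X] / (f)`. -/
abbrev PolyQuot : Type u := R[X] ⧸ Ideal.span {f}

variable (N : Type v) [AddCommGroup N] [Module R N]

/-- The projection `N[X] → N[X] / f N[X]`. -/
noncomputable def polyMk : R[X] ⊗[R] N →ₗ[R] PolyQuot f ⊗[R] N :=
  (Ideal.Quotient.mkₐ R (Ideal.span {f})).toLinearMap.rTensor N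

theorem polyMk_surjective : Function.Surjective (polyMk f N) :=
  LinearMap.rTensor_surjective N (Ideal.Quotient.mkₐ_surjective R _)

theorem polyMk_eq_zero_iff (x : R[X] ⊗[R] N) :
    polyMk f N x = 0 ↔ ∃ y : R[X] ⊗[R] N, f • y = x := by
  have hex : Function.Exact (LinearMap.mulLeft R f)
      (Ideal.Quotient.mkₐ R (Ideal.span {f})).toLinearMap := by
    intro p
    simp only [AlgHom.toLinearMap_apply, Ideal.Quotient.mkₐ_eq_mk,
      Ideal.Quotient.eq_zero_iff_mem, Ideal.mem_span_singleton, Set.mem_range,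
      LinearMap.mulLeft_apply]
    exact ⟨fun ⟨c, hc⟩ => ⟨c, hc.symm⟩, fun ⟨c, hc⟩ => ⟨c, hc.symm⟩⟩
  have := rTensor_exact N hex (Ideal.Quotient.mkₐ_surjective R _) x
  have hmul : ∀ y : R[X] ⊗[R] N, (LinearMap.mulLeft R f).rTensor N y = f • y := by
    intro y
    induction y with
    | zero => simp
    | add a b ha hb => rw [map_add, ha, hb, smul_add]
    | tmul p n => simp [TensorProduct.smul_tmul']
  rw [Set.mem_range] at this
  simp only [hmul] at this
  exact this

variable {N}
variable {P : Type w} [AddCommGroup P] [Module R P]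

theorem polyMk_lTensor (φ : N →ₗ[R] P) (x : R[X] ⊗[R] N) :
    φ.lTensor (PolyQuot f) (polyMk f N x) = polyMk f P (φ.lTensor R[X] x) := by
  simp only [polyMk, ← LinearMap.comp_apply, LinearMap.lTensor_comp_rTensor,
    LinearMap.rTensor_comp_lTensor]

theorem lTensor_smul (φ : N →ₗ[R] P) (p : R[X]) (x : R[X] ⊗[R] N) :
    φ.lTensor R[X] (p • x) = p • φ.lTensor R[X] x :=
  map_smul (φ.baseChange R[X]) p x

theorem smul_one_tmul (n : N) : f • ((1 : R[X]) ⊗ₜ[R] n) =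
    ∑ i ∈ f.support, (X ^ i : R[X]) ⊗ₜ[R] (f.coeff i • n) := by
  conv_lhs => rw [TensorProduct.smul_tmul', smul_eq_mul, mul_one, f.as_sum_support_C_mul_X_pow,
    TensorProduct.sum_tmul]
  refine Finset.sum_congr rfl fun i _ => ?_
  rw [← smul_eq_C_mul, TensorProduct.smul_tmul]

end Quotient

section Exact

universe u₁ u₂ u₃

variable {R : Type u} [CommRing R] {f : R[X]}
  {A : Type u₁} {B : Type u₂} {C : Type u₃} [AddCommGroup A] [AddCommGroup B]
  [AddCommGroup C] [Module R A] [Module R B] [Module R C]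
  {φ : A →ₗ[R] B} {ψ : B →ₗ[R] C}

/-- If `φ x = f y`, then `f` kills `ψ y`, so `ψ y = 0` by McCoy; thus `y` comes from `A[X]`, and `f`
divides `x`. -/
theorem lTensor_polyQuot_injective (hφ : Function.Injective φ) (hex : Function.Exact φ ψ)
    (hC : CoeffTorsionFree f C) :
    Function.Injective (φ.lTensor (PolyQuot f)) := by
  rw [injective_iff_map_eq_zero]
  intro q hq
  obtain ⟨x, rfl⟩ := polyMk_surjective f A q
  rw [polyMk_lTensor, polyMk_eq_zero_iff] at hq
  obtain ⟨y, hy⟩ := hq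
  have hex' : Function.Exact (φ.lTensor R[X]) (ψ.lTensor R[X]) :=
    Module.Flat.lTensor_exact R[X] hex
  have hy0 : ψ.lTensor R[X] y = 0 := by
    refine hC.isSMulRegular.right_eq_zero_of_smul ?_
    rw [← lTensor_smul, hy, hex'.apply_apply_eq_zero]
  obtain ⟨z, rfl⟩ := (hex' y).mp hy0
  rw [polyMk_eq_zero_iff]
  refine ⟨z, Module.Flat.lTensor_preserves_injective_linearMap φ hφ ?_⟩
  rw [lTensor_smul, hy]

/-- The vanishing of the coefficient torsion of a cokernel, from depth two of the submodule. -/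
theorem CoeffTorsionFree.of_exact (hφ : Function.Injective φ) (hex : Function.Exact φ ψ)
    (hψ : Function.Surjective ψ)
    (hQA : CoeffTorsionFree f (PolyQuot f ⊗[R] A)) (hB : CoeffTorsionFree f B) :
    CoeffTorsionFree f C := by
  intro c hc
  obtain ⟨b, rfl⟩ := hψ c
  have hα : ∀ i, ∃ a, φ a = f.coeff i • b := fun i =>
    (hex _).mp (by rw [map_smul, hc i])
  choose α hα using hα
  -- `y` represents `f • b` inside `A[X]`. Since `fⱼ αᵢ = fᵢ αⱼ`, one has `fⱼ y = f • αⱼ`, so the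
  -- class of `y` modulo `f` is coefficient torsion and `y = f z`. Cancelling `f` in `B[X]` gives `φ
  -- z = b`.
  let y : R[X] ⊗[R] A := ∑ i ∈ f.support, (X ^ i : R[X]) ⊗ₜ[R] α i
  have hφy : φ.lTensor R[X] y = f • ((1 : R[X]) ⊗ₜ[R] b) := by
    simp only [y, map_sum, LinearMap.lTensor_tmul, hα, smul_one_tmul]
  have hy : polyMk f A y = 0 := by
    refine hQA _ fun j => ?_
    rw [← map_smul, polyMk_eq_zero_iff]
    refine ⟨1 ⊗ₜ[R] α j, ?_⟩
    rw [smul_one_tmul, Finset.smul_sum]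
    refine Finset.sum_congr rfl fun i _ => ?_
    rw [← TensorProduct.tmul_smul]
    congr 1
    refine hφ ?_
    rw [map_smul, map_smul, hα, hα, smul_comm]
  obtain ⟨z, hz⟩ := (polyMk_eq_zero_iff f A y).mp hy
  have hz' : φ.lTensor R[X] z = (1 : R[X]) ⊗ₜ[R] b := by
    refine hB.isSMulRegular ?_
    change f • _ = f • _
    rw [← lTensor_smul, hz, hφy]
  -- Taking constant coefficients of `φ z = b` puts `b` in the image of `A`.
  have hev : ∀ x : R[X] ⊗[R] A, TensorProduct.lid R B ((lcoeff R 0).rTensor B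
      (φ.lTensor R[X] x)) = φ (TensorProduct.lid R A ((lcoeff R 0).rTensor A x)) := by
    intro x
    induction x with
    | zero => simp
    | add a b ha hb => simp only [map_add, ha, hb]
    | tmul p n => simp
  have := hev z
  rw [hz'] at this
  simp only [LinearMap.rTensor_tmul, lcoeff_apply, coeff_one_zero, TensorProduct.lid_tmul,
    one_smul] at this
  rw [this, hex.apply_apply_eq_zero]

end Exact

/-! ### Polynomial depth and the depth lemmas -/

/-- `PolyDepthGE f k N` means that the depth of `N` in the content ideal of `f` is at least `k`:
each of `N, Q ⊗ N, …, Q ^ (k - 1) ⊗ N` is free of coefficient torsion, where `Q = R[X] / (f)`. -/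
def PolyDepthGE {R : Type u} [CommRing R] (f : R[X]) :
    ℕ → (N : Type (max u w)) → [AddCommGroup N] → [Module R N] → Prop
  | 0, _, _, _ => True
  | k + 1, N, _, _ => CoeffTorsionFree f N ∧ PolyDepthGE f k (PolyQuot f ⊗[R] N)

/-- An element killed by the content ideal is killed by every map with coefficients in that ideal.
-/
theorem CoeffTorsionFree.of_injective_of_mem_smul {R : Type u} [CommRing R] {f : R[X]}
    {A : Type v} {B : Type w} [AddCommGroup A] [AddCommGroup B] [Module R A] [Module R B]
    {φ : A →ₗ[R] B} (hφ : φ ∈ f.contentIdeal • (⊤ : Submodule R (A →ₗ[R] B)))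
    (hinj : Function.Injective φ) : CoeffTorsionFree f A := by
  intro x hx
  have hann : f.contentIdeal ≤ LinearMap.ker (LinearMap.toSpanSingleton R A x) := by
    rw [contentIdeal_def, Ideal.span_le]
    intro r hr
    obtain ⟨i, -, rfl⟩ := mem_coeffs_iff.mp hr
    simpa using hx i
  refine hinj ?_
  rw [map_zero]
  refine Submodule.smul_induction_on hφ (fun r hr χ _ => ?_) fun χ₁ χ₂ h₁ h₂ => ?_
  · have := hann hr
    rw [LinearMap.mem_ker, LinearMap.toSpanSingleton_apply] at this
    rw [LinearMap.smul_apply, ← map_smul, this, map_zero]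
  · rw [LinearMap.add_apply, h₁, h₂, add_zero]

namespace PolyDepthGE

variable {R : Type u} [CommRing R] {f : R[X]}

theorem of_succ {k : ℕ} : ∀ {N : Type (max u w)} [AddCommGroup N] [Module R N],
    PolyDepthGE.{u, w} f (k + 1) N → PolyDepthGE.{u, w} f k N := by
  induction k with
  | zero => intros; trivial
  | succ k ih => exact fun h => ⟨h.1, ih h.2⟩

theorem mono {k l : ℕ} (hkl : k ≤ l) {N : Type (max u w)} [AddCommGroup N] [Module R N]
    (h : PolyDepthGE.{u, w} f l N) : PolyDepthGE.{u, w} f k N := by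
  induction hkl with
  | refl => exact h
  | step _ ih => exact ih h.of_succ

theorem of_retract {k : ℕ} : ∀ {N : Type (max u w)} {P : Type (max u w')} [AddCommGroup N]
    [Module R N] [AddCommGroup P] [Module R P] (i : N →ₗ[R] P) (r : P →ₗ[R] N),
    r ∘ₗ i = LinearMap.id → PolyDepthGE.{u, w'} f k P → PolyDepthGE.{u, w} f k N := by
  induction k with
  | zero => intros; trivial
  | succ k ih =>
    intro N P _ _ _ _ i r hri h
    refine ⟨h.1.of_injective i (LinearMap.injective_of_comp_eq_id i r hri), ?_⟩
    refine ih (i.lTensor _) (r.lTensor _) ?_ h.2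
    rw [← LinearMap.lTensor_comp, hri, LinearMap.lTensor_id]

theorem congr {k : ℕ} {N : Type (max u w)} {P : Type (max u w')} [AddCommGroup N] [Module R N]
    [AddCommGroup P] [Module R P] (e : N ≃ₗ[R] P) :
    PolyDepthGE.{u, w} f k N ↔ PolyDepthGE.{u, w'} f k P :=
  ⟨of_retract e.symm.toLinearMap e.toLinearMap (by ext; simp),
    of_retract e.toLinearMap e.symm.toLinearMap (by ext; simp)⟩

/-- The depth lemma for a cokernel. -/
theorem of_exact_right {k : ℕ} : ∀ {A B C : Type (max u w)} [AddCommGroup A] [AddCommGroup B]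
    [AddCommGroup C] [Module R A] [Module R B] [Module R C] {φ : A →ₗ[R] B} {ψ : B →ₗ[R] C},
    Function.Injective φ → Function.Exact φ ψ → Function.Surjective ψ →
    PolyDepthGE.{u, w} f (k + 1) A → PolyDepthGE.{u, w} f k B → PolyDepthGE.{u, w} f k C := by
  induction k with
  | zero => intros; trivial
  | succ k ih =>
    intro A B C _ _ _ _ _ _ φ ψ hφ hex hψ hA hB
    have hC : CoeffTorsionFree f C := .of_exact hφ hex hψ hA.2.1 hB.1
    exact ⟨hC, ih (lTensor_polyQuot_injective hφ hex hC) (lTensor_exact _ hex hψ)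
      (LinearMap.lTensor_surjective _ hψ) hA.2 hB.2⟩

/-- The depth lemma for a kernel. -/
theorem of_exact_left {k : ℕ} : ∀ {A B C : Type (max u w)} [AddCommGroup A] [AddCommGroup B]
    [AddCommGroup C] [Module R A] [Module R B] [Module R C] {φ : A →ₗ[R] B} {ψ : B →ₗ[R] C},
    Function.Injective φ → Function.Exact φ ψ → Function.Surjective ψ →
    PolyDepthGE.{u, w} f (k + 1) B → PolyDepthGE.{u, w} f k C →
      PolyDepthGE.{u, w} f (k + 1) A := by
  induction k with
  | zero => exact fun hφ _ _ hB _ => ⟨hB.1.of_injective _ hφ, trivial⟩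
  | succ k ih =>
    intro A B C _ _ _ _ _ _ φ ψ hφ hex hψ hB hC
    exact ⟨hB.1.of_injective _ hφ, ih (lTensor_polyQuot_injective hφ hex hC.1)
      (lTensor_exact _ hex hψ) (LinearMap.lTensor_surjective _ hψ) hB.2 hC.2⟩

/-- The depth lemma for an extension. -/
theorem of_exact_middle {k : ℕ} : ∀ {A B C : Type (max u w)} [AddCommGroup A] [AddCommGroup B]
    [AddCommGroup C] [Module R A] [Module R B] [Module R C] {φ : A →ₗ[R] B} {ψ : B →ₗ[R] C},
    Function.Injective φ → Function.Exact φ ψ → Function.Surjective ψ →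
    PolyDepthGE.{u, w} f k A → PolyDepthGE.{u, w} f k C → PolyDepthGE.{u, w} f k B := by
  induction k with
  | zero => intros; trivial
  | succ k ih =>
    intro A B C _ _ _ _ _ _ φ ψ hφ hex hψ hA hC
    refine ⟨fun b hb => ?_, ih (lTensor_polyQuot_injective hφ hex hC.1)
      (lTensor_exact _ hex hψ) (LinearMap.lTensor_surjective _ hψ) hA.2 hC.2⟩
    obtain ⟨a, rfl⟩ := (hex b).mp (hC.1 _ fun i => by rw [← map_smul, hb i, map_zero])
    rw [hA.1 a fun i => hφ (by rw [map_smul, hb i, map_zero]), map_zero]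

/-- An injection with coefficients in the content ideal raises the depth of its source above that
of its cokernel. -/
theorem of_exact_of_mem_smul {k : ℕ} : ∀ {A B C : Type (max u w)} [AddCommGroup A]
    [AddCommGroup B] [AddCommGroup C] [Module R A] [Module R B] [Module R C]
    {φ : A →ₗ[R] B} {ψ : B →ₗ[R] C},
    φ ∈ f.contentIdeal • (⊤ : Submodule R (A →ₗ[R] B)) →
    Function.Injective φ → Function.Exact φ ψ → Function.Surjective ψ →
    PolyDepthGE.{u, w} f k B → PolyDepthGE.{u, w} f k C → PolyDepthGE.{u, w} f (k + 1) A := by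
  induction k with
  | zero =>
    intro A B C _ _ _ _ _ _ φ ψ hφ hinj _ _ _ _
    exact ⟨.of_injective_of_mem_smul hφ hinj, trivial⟩
  | succ k ih =>
    intro A B C _ _ _ _ _ _ φ ψ hφ hinj hex hψ hB hC
    refine ⟨.of_injective_of_mem_smul hφ hinj, ih ?_
      (lTensor_polyQuot_injective hinj hex hC.1) (lTensor_exact _ hex hψ)
      (LinearMap.lTensor_surjective _ hψ) hB.2 hC.2⟩
    -- `φ ↦ Q ⊗ φ` is linear, so it preserves membership in the ideal multiple.
    rw [← LinearMap.coe_lTensorHom]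
    have := Submodule.mem_map_of_mem (f := LinearMap.lTensorHom (PolyQuot f)) hφ
    rw [Submodule.map_smul''] at this
    exact Submodule.smul_mono le_rfl le_top this

/-- Source and target coincide, so each bound obtained for the source feeds back as the bound needed
on the target. -/
theorem of_exact_of_mem_smul_end {k : ℕ} {A C : Type (max u w)} [AddCommGroup A]
    [AddCommGroup C] [Module R A] [Module R C] {φ : A →ₗ[R] A} {ψ : A →ₗ[R] C}
    (hφ : φ ∈ f.contentIdeal • (⊤ : Submodule R (A →ₗ[R] A)))
    (hinj : Function.Injective φ) (hex : Function.Exact φ ψ) (hψ : Function.Surjective ψ)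
    (hC : PolyDepthGE.{u, w} f k C) : PolyDepthGE.{u, w} f (k + 1) A := by
  induction k with
  | zero => exact of_exact_of_mem_smul hφ hinj hex hψ trivial hC
  | succ k ih => exact of_exact_of_mem_smul hφ hinj hex hψ (ih hC.of_succ) hC

theorem of_subsingleton {k : ℕ} : ∀ {N : Type (max u w)} [AddCommGroup N] [Module R N]
    [Subsingleton N], PolyDepthGE.{u, w} f k N := by
  induction k with
  | zero => intros; trivial
  | succ k ih => exact fun {N} _ _ _ => ⟨fun n _ => Subsingleton.elim _ _, ih⟩

theorem pi {k : ℕ} {N : Type (max u w)} [AddCommGroup N] [Module R N]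
    (h : PolyDepthGE.{u, w} f k N) (n : ℕ) : PolyDepthGE.{u, w} f k (Fin n → N) := by
  induction n with
  | zero => exact of_subsingleton
  | succ n ih =>
    refine (congr (Fin.consLinearEquiv R fun _ : Fin (n + 1) => N)).mp ?_
    refine of_exact_middle (φ := LinearMap.inl R N (Fin n → N)) (ψ := LinearMap.snd R N _)
      LinearMap.inl_injective .inl_snd LinearMap.snd_surjective h ih

theorem pi_iff {k n : ℕ} {N : Type (max u w)} [AddCommGroup N] [Module R N] (hn : 0 < n) :
    PolyDepthGE.{u, w} f k (Fin n → N) ↔ PolyDepthGE.{u, w} f k N :=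
  ⟨of_retract (LinearMap.single R (fun _ : Fin n => N) ⟨0, hn⟩) (LinearMap.proj ⟨0, hn⟩)
    (by ext; simp),
    fun h => h.pi n⟩

/-- Descent along a faithfully flat algebra. -/
theorem of_tensorProduct {S : Type u} [CommRing S] [Algebra R S] [Module.FaithfullyFlat R S]
    {k : ℕ} : ∀ {N : Type (max u w)} [AddCommGroup N] [Module R N],
    PolyDepthGE.{u, w} f k (S ⊗[R] N) → PolyDepthGE.{u, w} f k N := by
  induction k with
  | zero => intros; trivial
  | succ k ih =>
    intro N _ _ h
    exact ⟨h.1.of_injective (TensorProduct.mk R S N 1)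
      (Module.FaithfullyFlat.tensorProduct_mk_injective N),
      ih ((congr (TensorProduct.leftComm R (PolyQuot f) S N)).mp h.2)⟩

open RingTheory.Sequence Pointwise in
/-- A weakly regular sequence in the extension of the content ideal bounds the depth below. -/
theorem of_isWeaklyRegular {S : Type u} [CommRing S] [Algebra R S] (rs : List S) :
    ∀ {P : Type (max u w)} [AddCommGroup P] [Module R P] [Module S P] [IsScalarTower R S P],
    (∀ s ∈ rs, s ∈ f.contentIdeal.map (algebraMap R S)) → IsWeaklyRegular P rs →
      PolyDepthGE.{u, w} f rs.length P := by
  induction rs with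
  | nil => intros; trivial
  | cons s rs ih =>
    intro P _ _ _ _ hmem hreg
    rw [isWeaklyRegular_cons_iff] at hreg
    have hC := ih (fun t ht => hmem t (List.mem_cons_of_mem _ ht)) hreg.2
    have hs : Algebra.lsmul R R P s ∈ f.contentIdeal • (⊤ : Submodule R (P →ₗ[R] P)) := by
      have hs : s ∈ f.contentIdeal • (⊤ : Submodule R S) := by
        rw [Ideal.smul_top_eq_map]
        exact hmem s List.mem_cons_self
      have := Submodule.mem_map_of_mem (f := (Algebra.lsmul R R P).toLinearMap) hs
      rw [Submodule.map_smul''] at this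
      exact Submodule.smul_mono le_rfl le_top this
    have hex : Function.Exact (Algebra.lsmul R R P s)
        ((Submodule.mkQ (s • (⊤ : Submodule S P))).restrictScalars R) := by
      intro x
      rw [LinearMap.restrictScalars_apply, Submodule.mkQ_apply, Submodule.Quotient.mk_eq_zero,
        Submodule.mem_smul_pointwise_iff_exists]
      simp
    rw [List.length_cons]
    exact of_exact_of_mem_smul_end.{u, w}
      (ψ := (Submodule.mkQ (s • (⊤ : Submodule S P))).restrictScalars R) hs hreg.1 hex
      (Submodule.mkQ_surjective (s • (⊤ : Submodule S P))) hC

end PolyDepthGE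

/-! ### Finitely generated subideals as content ideals -/

section ContentIdeal

variable {R : Type u} [CommRing R]

theorem contentIdeal_le_iff {f : R[X]} {J : Ideal R} :
    f.contentIdeal ≤ J ↔ ∀ i, f.coeff i ∈ J := by
  refine ⟨fun h i => h (f.coeff_mem_contentIdeal i), fun h => ?_⟩
  rw [contentIdeal_def, Ideal.span_le]
  intro r hr
  obtain ⟨i, -, rfl⟩ := mem_coeffs_iff.mp hr
  exact h i

theorem exists_contentIdeal_eq_sup (f g : R[X]) :
    ∃ h : R[X], h.contentIdeal = f.contentIdeal ⊔ g.contentIdeal := by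
  -- Shifting `g` past the degree of `f` keeps the two sets of coefficients apart.
  refine ⟨f + X ^ (f.natDegree + 1) * g, le_antisymm ?_ (sup_le ?_ ?_)⟩
  · rw [contentIdeal_le_iff]
    intro i
    rw [coeff_add, coeff_X_pow_mul']
    refine add_mem (le_sup_left (a := f.contentIdeal) (f.coeff_mem_contentIdeal i)) ?_
    split_ifs
    · exact le_sup_right (a := f.contentIdeal) (g.coeff_mem_contentIdeal _)
    · exact zero_mem _
  · rw [contentIdeal_le_iff]
    intro i
    rcases le_or_gt i f.natDegree with hi | hi
    · have := (f + X ^ (f.natDegree + 1) * g).coeff_mem_contentIdeal i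
      rwa [coeff_add, coeff_X_pow_mul', if_neg (by omega), add_zero] at this
    · rw [coeff_eq_zero_of_natDegree_lt hi]
      exact zero_mem _
  · rw [contentIdeal_le_iff]
    intro i
    have := (f + X ^ (f.natDegree + 1) * g).coeff_mem_contentIdeal (i + (f.natDegree + 1))
    rwa [coeff_add, coeff_X_pow_mul, coeff_eq_zero_of_natDegree_lt (by omega), zero_add] at this

theorem exists_mem_contentIdeal_smul {P : Type v} [AddCommGroup P] [Module R P] {I : Ideal R}
    {x : P} (hx : x ∈ I • (⊤ : Submodule R P)) :
    ∃ f : R[X], f.contentIdeal ≤ I ∧ x ∈ f.contentIdeal • (⊤ : Submodule R P) := by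
  refine Submodule.smul_induction_on hx (fun r hr y _ => ⟨C r, ?_, ?_⟩) ?_
  · rwa [contentIdeal_C, Ideal.span_singleton_le_iff_mem]
  · rw [contentIdeal_C]
    exact Submodule.smul_mem_smul (Ideal.mem_span_singleton_self r) trivial
  · rintro x y ⟨f, hf, hx⟩ ⟨g, hg, hy⟩
    obtain ⟨h, hh⟩ := exists_contentIdeal_eq_sup f g
    refine ⟨h, hh ▸ sup_le hf hg, add_mem ?_ ?_⟩
    · exact Submodule.smul_mono (hh ▸ le_sup_left) le_rfl hx
    · exact Submodule.smul_mono (hh ▸ le_sup_right) le_rfl hy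

theorem exists_mem_map_contentIdeal {S : Type v} [CommRing S] [Algebra R S] {I : Ideal R}
    {s : S} (hs : s ∈ I.map (algebraMap R S)) :
    ∃ f : R[X], f.contentIdeal ≤ I ∧ s ∈ f.contentIdeal.map (algebraMap R S) := by
  have hs' : s ∈ I • (⊤ : Submodule R S) := by
    rwa [Ideal.smul_top_eq_map]
  obtain ⟨f, hf, h⟩ := exists_mem_contentIdeal_smul hs'
  rw [Ideal.smul_top_eq_map] at h
  exact ⟨f, hf, h⟩

theorem exists_forall_mem_map_contentIdeal {S : Type v} [CommRing S] [Algebra R S] {I : Ideal R}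
    (rs : List S) (hrs : ∀ s ∈ rs, s ∈ I.map (algebraMap R S)) :
    ∃ f : R[X], f.contentIdeal ≤ I ∧ ∀ s ∈ rs, s ∈ f.contentIdeal.map (algebraMap R S) := by
  induction rs with
  | nil => exact ⟨0, by simp, by simp⟩
  | cons s rs ih =>
    obtain ⟨f, hf, hs⟩ := exists_mem_map_contentIdeal (hrs s List.mem_cons_self)
    obtain ⟨g, hg, hrs⟩ := ih fun t ht => hrs t (List.mem_cons_of_mem _ ht)
    obtain ⟨h, hh⟩ := exists_contentIdeal_eq_sup f g
    refine ⟨h, hh ▸ sup_le hf hg, fun t ht => ?_⟩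
    rcases List.mem_cons.mp ht with rfl | ht
    · exact Ideal.map_mono (hh ▸ le_sup_left) hs
    · exact Ideal.map_mono (hh ▸ le_sup_right) (hrs t ht)

end ContentIdeal

/-! ### Comparison with regular sequences -/

section RegularSequence

open RingTheory.Sequence

variable {R : Type u} [CommRing R] {f : R[X]}

open scoped Pointwise in
theorem isWeaklyRegular_cons_of_ker_eq {S T : Type*} [CommRing S] [CommRing T] [Algebra S T]
    {P D : Type*} [AddCommGroup P] [AddCommGroup D] [Module S P] [Module T P] [IsScalarTower S T P]
    [Module S D] {t : T} (ht : IsSMulRegular P t) (Φ : P →ₗ[S] D) (hΦs : Function.Surjective Φ)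
    (hΦ : ∀ x, Φ x = 0 ↔ ∃ y, t • y = x) {rs : List S} (hrs : IsWeaklyRegular D rs) :
    IsWeaklyRegular P (t :: rs.map (algebraMap S T)) := by
  refine .cons ht ?_
  rw [isWeaklyRegular_map_algebraMap_iff]
  have hker : LinearMap.ker Φ = (t • (⊤ : Submodule T P)).restrictScalars S := by
    ext x
    rw [LinearMap.mem_ker, Submodule.restrictScalars_mem,
      Submodule.mem_smul_pointwise_iff_exists, hΦ]
    simp
  let e : QuotSMulTop t P ≃ₗ[S] D := (Submodule.Quotient.restrictScalarsEquiv S _).symm ≪≫ₗ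
    Submodule.quotEquivOfEq _ _ hker.symm ≪≫ₗ Φ.quotKerEquivOfSurjective hΦs
  exact (e.isWeaklyRegular_congr rs).mpr hrs

/-- A weakly regular sequence on `S ⊗ N[X] / f N[X]` extends to one on `S[X] ⊗ N` by adding the
first term `f`. -/
theorem isWeaklyRegular_cons_of_polyQuot {S : Type v} [CommRing S] [Algebra R S]
    [Module.Flat R S] {N : Type w} [AddCommGroup N] [Module R N] (hN : CoeffTorsionFree f N)
    {rs : List S} (hrs : IsWeaklyRegular (S ⊗[R] (PolyQuot f ⊗[R] N)) rs) :
    IsWeaklyRegular ((S ⊗[R] R[X]) ⊗[R] N)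
      ((1 ⊗ₜ f : S ⊗[R] R[X]) :: rs.map (algebraMap S (S ⊗[R] R[X]))) := by
  let e := TensorProduct.AlgebraTensorModule.assoc R R S S R[X] N
  let μ : R[X] ⊗[R] N →ₗ[R] R[X] ⊗[R] N := Algebra.lsmul R R (R[X] ⊗[R] N) f
  have hμ : ∀ y, e ((1 ⊗ₜ f : S ⊗[R] R[X]) • y) = μ.lTensor S (e y) := by
    intro y
    induction y with
    | zero => simp
    | add a b ha hb => rw [smul_add, map_add, map_add, map_add, ha, hb]
    | tmul t n =>
      induction t with
      | zero => simp
      | add a b ha hb => rw [TensorProduct.add_tmul, smul_add, map_add, map_add, map_add, ha, hb]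
      | tmul s p =>
        rw [TensorProduct.smul_tmul', smul_eq_mul, Algebra.TensorProduct.tmul_mul_tmul, one_mul]
        simp [e, μ, TensorProduct.smul_tmul']
  let Φ : (S ⊗[R] R[X]) ⊗[R] N →ₗ[S] S ⊗[R] (PolyQuot f ⊗[R] N) :=
    (polyMk f N).baseChange S ∘ₗ e.toLinearMap
  have hΦs : Function.Surjective Φ :=
    (LinearMap.lTensor_surjective S (polyMk_surjective f N)).comp e.surjective
  have hex : Function.Exact (μ.lTensor S) ((polyMk f N).lTensor S) :=
    lTensor_exact S (fun x => polyMk_eq_zero_iff f N x) (polyMk_surjective f N)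
  refine isWeaklyRegular_cons_of_ker_eq (fun x y hxy => ?_) Φ hΦs (fun x => ?_) hrs
  · refine e.injective (Module.Flat.lTensor_preserves_injective_linearMap μ hN.isSMulRegular ?_)
    rw [← hμ, ← hμ]
    exact congrArg e hxy
  · refine (hex (e x)).trans ⟨?_, ?_⟩
    · rintro ⟨y, hy⟩
      refine ⟨e.symm y, e.injective ?_⟩
      rw [hμ, e.apply_symm_apply, hy]
    · rintro ⟨y, rfl⟩
      exact ⟨e y, (hμ y).symm⟩

theorem one_tmul_mem_map_contentIdeal (S : Type v) [CommRing S] [Algebra R S] :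
    (1 ⊗ₜ f : S ⊗[R] R[X]) ∈ f.contentIdeal.map (algebraMap R (S ⊗[R] R[X])) := by
  have h : (1 ⊗ₜ f : S ⊗[R] R[X]) = ∑ i ∈ f.support, 1 ⊗ₜ (C (f.coeff i) * X ^ i) := by
    rw [← TensorProduct.tmul_sum, ← f.as_sum_support_C_mul_X_pow]
  rw [h]
  refine sum_mem fun i _ => ?_
  rw [← smul_eq_C_mul, TensorProduct.tmul_smul,
    ← algebraMap_smul (S ⊗[R] R[X]) (f.coeff i), smul_eq_mul]
  exact Ideal.mul_mem_right _ _ (Ideal.mem_map_of_mem _ (f.coeff_mem_contentIdeal i))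

/-- A lower bound for the depth is realised by a weakly regular sequence over a faithfully flat
algebra. -/
theorem PolyDepthGE.exists_isWeaklyRegular [Nontrivial R] {k : ℕ} :
    ∀ {N : Type (max u w)} [AddCommGroup N] [Module R N], PolyDepthGE.{u, w} f k N →
    ∃ (S : Type u) (_ : CommRing S) (_ : Algebra R S) (_ : Module.FaithfullyFlat R S)
      (rs : List S), rs.length = k ∧ (∀ s ∈ rs, s ∈ f.contentIdeal.map (algebraMap R S)) ∧
        IsWeaklyRegular (S ⊗[R] N) rs := by
  induction k with
  | zero => exact fun _ => ⟨R, _, _, inferInstance, [], rfl, by simp, .nil _ _⟩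
  | succ k ih =>
    intro N _ _ h
    obtain ⟨S, _, _, _, rs, hlen, hmem, hreg⟩ := ih h.2
    refine ⟨S ⊗[R] R[X], inferInstance, inferInstance, .trans R S _,
      _, ?_, ?_, isWeaklyRegular_cons_of_polyQuot h.1 hreg⟩
    · rw [List.length_cons, List.length_map, hlen]
    · intro t ht
      rcases List.mem_cons.mp ht with rfl | ht
      · exact one_tmul_mem_map_contentIdeal S
      · obtain ⟨s, hs, rfl⟩ := List.mem_map.mp ht
        rw [IsScalarTower.algebraMap_eq R S (S ⊗[R] R[X]), ← Ideal.map_map]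
        exact Ideal.mem_map_of_mem _ (hmem s hs)

/-- A sequence realising the bound for `f` has its terms in the larger extended ideal, which bounds
the depth for `g` after base change; then descend. -/
theorem PolyDepthGE.of_contentIdeal_le [Nontrivial R] {g : R[X]}
    (hfg : f.contentIdeal ≤ g.contentIdeal) {k : ℕ} {N : Type (max u w)} [AddCommGroup N]
    [Module R N] (h : PolyDepthGE.{u, w} f k N) : PolyDepthGE.{u, w} g k N := by
  obtain ⟨S, _, _, _, rs, rfl, hmem, hreg⟩ := h.exists_isWeaklyRegular
  exact .of_tensorProduct (S := S)
    (.of_isWeaklyRegular rs (fun s hs => Ideal.map_mono hfg (hmem s hs)) hreg)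

end RegularSequence

section Depth

open RingTheory.Sequence

variable {R : Type u} [CommRing R] [IsLocalRing R] {N : Type v} [AddCommGroup N] [Module R N]

-- A regular sequence involves only finitely many elements of `𝔪`, which form the coefficients of
-- one `f`. The `ULift` puts `N` in a universe stable under `Q ⊗ -`.
open IsLocalRing in
theorem le_depth_iff [Module.Finite R N] [Nontrivial N] (k : ℕ) :
    (k : ℕ∞) ≤ depth R N ↔ ∃ f : R[X], f.contentIdeal ≤ maximalIdeal R ∧
      PolyDepthGE.{u, v} f k (ULift.{u} N) := by
  have eN : ∀ (S : Type u) [CommRing S] [Algebra R S] (rs : List S),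
      IsWeaklyRegular (S ⊗[R] N) rs ↔ IsWeaklyRegular (S ⊗[R] ULift.{u} N) rs := fun S _ _ rs =>
    LinearEquiv.isWeaklyRegular_congr
      (TensorProduct.AlgebraTensorModule.congr (.refl S S) ULift.moduleEquiv.symm) rs
  constructor
  · intro h
    cases k with
    | zero => exact ⟨0, by simp, trivial⟩
    | succ k =>
      -- The strict inequality yields an actual sequence of length at least `k + 1`.
      have hlt : (k : ℕ∞) < depth R N := lt_of_lt_of_le (by exact_mod_cast k.lt_succ_self) h
      simp only [depth, idealDepth, classicalDepth, lt_iSup_iff] at hlt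
      obtain ⟨S, _, _, _, rs, hmem, hreg, hlen⟩ := hlt
      obtain ⟨f, hf, hmem⟩ := exists_forall_mem_map_contentIdeal rs hmem
      have := PolyDepthGE.of_isWeaklyRegular.{u, v} rs hmem ((eN S rs).mp hreg.toIsWeaklyRegular)
      refine ⟨f, hf, .of_tensorProduct (S := S) (this.mono ?_)⟩
      exact_mod_cast hlen
  · rintro ⟨f, hf, h⟩
    obtain ⟨S, _, _, hS, rs, rfl, hmem, hreg⟩ := h.exists_isWeaklyRegular
    have hmem' : ∀ s ∈ rs, s ∈ (maximalIdeal R).map (algebraMap R S) := fun s hs =>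
      Ideal.map_mono hf (hmem s hs)
    have hreg' : IsRegular (S ⊗[R] N) rs := by
      refine ⟨(eN S rs).mpr hreg, fun htop => ?_⟩
      -- Nakayama gives `𝔪 N ≠ N`, and faithful flatness preserves this; hence weakly regular
      -- implies regular here.
      have hne : (maximalIdeal R).map (algebraMap R S) • (⊤ : Submodule S (S ⊗[R] N)) ≠ ⊤ := by
        rw [(TensorProduct.isBaseChange R N S).map_smul_top_ne_top_iff_of_faithfullyFlat]
        exact (Submodule.top_ne_ideal_smul_of_le_jacobson_annihilator
          (maximalIdeal_le_jacobson _)).symm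
      exact hne (top_le_iff.mp (htop.le.trans
        (Submodule.smul_mono (Ideal.span_le.mpr hmem') le_rfl)))
    simp only [depth, idealDepth, classicalDepth]
    exact le_iSup_of_le S <| le_iSup_of_le _ <| le_iSup_of_le _ <| le_iSup_of_le hS <|
      le_iSup_of_le rs <| le_iSup_of_le hmem' <| le_iSup_of_le hreg' le_rfl

end Depth

/-! ### Depth of a module and of its syzygy -/

section Syzygy

variable {R : Type u} [CommRing R] {f : R[X]} {A F M R₀ : Type (max u w)}
  [AddCommGroup A] [AddCommGroup F] [AddCommGroup M] [AddCommGroup R₀]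
  [Module R A] [Module R F] [Module R M] [Module R R₀] {φ : A →ₗ[R] F} {ψ : F →ₗ[R] M}

namespace PolyDepthGE

/-- If the depth of a syzygy of `M` falls short of the depth of `R₀` by `n + 1`, then that of `M`
falls short of it by `n + 2`. -/
theorem iff_of_exact (hφ : Function.Injective φ) (hex : Function.Exact φ ψ)
    (hψ : Function.Surjective ψ) (n : ℕ)
    (hF : ∀ k, PolyDepthGE.{u, w} f k R₀ → PolyDepthGE.{u, w} f k F)
    (hA : ∀ k, PolyDepthGE.{u, w} f k A ↔ PolyDepthGE.{u, w} f (k + (n + 1)) R₀) (k : ℕ) :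
    PolyDepthGE.{u, w} f k M ↔ PolyDepthGE.{u, w} f (k + (n + 2)) R₀ := by
  have hA' : ∀ k, PolyDepthGE.{u, w} f (k + 1) A ↔ PolyDepthGE.{u, w} f (k + (n + 2)) R₀ := by
    intro k
    rw [hA, show k + 1 + (n + 1) = k + (n + 2) by omega]
  refine ⟨fun h => ?_, fun h => .of_exact_right hφ hex hψ ((hA' k).mpr h)
    (hF k (h.mono (by omega)))⟩
  rw [← hA']
  induction k with
  | zero =>
    -- The gap of at least one between `A` and `R₀` starts the bootstrap: `F` is always one step
    -- ahead of what is known for `A`.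
    have h₀ : PolyDepthGE.{u, w} f (0 + (n + 1)) R₀ := (hA 0).mp trivial
    exact .of_exact_left hφ hex hψ (hF _ (h₀.mono (by omega))) h
  | succ k ih =>
    have h₁ := (hA' k).mp (ih h.of_succ)
    exact .of_exact_left hφ hex hψ (hF _ (h₁.mono (by omega))) h

/-- If the first syzygy of `M` has the depth of `R₀` and lies in the content ideal, then the depth
of `M` falls short of that of `R₀` by one. -/
theorem iff_of_exact_of_mem_smul (hφ : Function.Injective φ) (hex : Function.Exact φ ψ)
    (hψ : Function.Surjective ψ) (hmem : φ ∈ f.contentIdeal • (⊤ : Submodule R (A →ₗ[R] F)))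
    (hF : ∀ k, PolyDepthGE.{u, w} f k R₀ → PolyDepthGE.{u, w} f k F)
    (hA : ∀ k, PolyDepthGE.{u, w} f k A ↔ PolyDepthGE.{u, w} f k R₀) (k : ℕ) :
    PolyDepthGE.{u, w} f k M ↔ PolyDepthGE.{u, w} f (k + 1) R₀ := by
  refine ⟨fun h => ?_, fun h => .of_exact_right hφ hex hψ ((hA _).mpr h) (hF k h.of_succ)⟩
  rw [← hA]
  induction k with
  | zero => exact .of_exact_of_mem_smul hmem hφ hex hψ trivial h
  | succ k ih => exact .of_exact_of_mem_smul hmem hφ hex hψ (hF _ ((hA _).mp (ih h.of_succ))) h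

end PolyDepthGE

end Syzygy

section ULift

variable {R : Type u} [CommRing R] {f : R[X]} {A : Type v} {B : Type v}
  [AddCommGroup A] [AddCommGroup B] [Module R A] [Module R B]

/-- The lift of a linear map to a larger universe. -/
def uliftMap (φ : A →ₗ[R] B) : ULift.{u} A →ₗ[R] ULift.{u} B :=
  ULift.moduleEquiv.symm.toLinearMap ∘ₗ φ ∘ₗ ULift.moduleEquiv.toLinearMap

theorem uliftMap_injective {φ : A →ₗ[R] B} (hφ : Function.Injective φ) :
    Function.Injective (uliftMap φ) := fun _ _ h => ULift.ext _ _ (hφ (congrArg ULift.down h))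

theorem uliftMap_surjective {φ : A →ₗ[R] B} (hφ : Function.Surjective φ) :
    Function.Surjective (uliftMap φ) := fun y => by
  obtain ⟨x, hx⟩ := hφ y.down
  exact ⟨⟨x⟩, ULift.ext _ _ hx⟩

theorem uliftMap_exact {C : Type v} [AddCommGroup C] [Module R C] {φ : A →ₗ[R] B}
    {ψ : B →ₗ[R] C} (h : Function.Exact φ ψ) : Function.Exact (uliftMap φ) (uliftMap ψ) := by
  intro y
  refine Iff.trans ⟨fun hy => congrArg ULift.down hy, fun hy => ULift.ext _ _ hy⟩
    ((h y.down).trans ⟨?_, ?_⟩)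
  · rintro ⟨x, hx⟩
    exact ⟨⟨x⟩, ULift.ext _ _ hx⟩
  · rintro ⟨x, hx⟩
    exact ⟨x.down, congrArg ULift.down hx⟩

theorem uliftMap_mem_smul {J : Ideal R} {φ : A →ₗ[R] B}
    (hφ : φ ∈ J • (⊤ : Submodule R (A →ₗ[R] B))) :
    uliftMap φ ∈ J • (⊤ : Submodule R (ULift.{u} A →ₗ[R] ULift.{u} B)) := by
  have := Submodule.mem_map_of_mem (f := (LinearEquiv.arrowCongr
    (ULift.moduleEquiv.{u} (R := R) (M := A)).symm
    (ULift.moduleEquiv.{u} (R := R) (M := B)).symm).toLinearMap) hφ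
  rw [Submodule.map_smul''] at this
  exact Submodule.smul_mono le_rfl le_top this

theorem polyDepthGE_ulift_iff_of_free [Module.Free R A] [Module.Finite R A] [Nontrivial A]
    (k : ℕ) : PolyDepthGE.{u, v} f k (ULift.{u} A) ↔ PolyDepthGE.{u, v} f k (ULift.{v} R) := by
  have : Nontrivial R := Module.nontrivial R A
  let b := Module.finBasis R A
  let e : ULift.{u} A ≃ₗ[R] (Fin (Module.finrank R A) → ULift.{v} R) :=
    ULift.moduleEquiv ≪≫ₗ b.equivFun ≪≫ₗ
      LinearEquiv.piCongrRight fun _ => ULift.moduleEquiv.symm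
  rw [PolyDepthGE.congr e, PolyDepthGE.pi_iff (Fin.pos_iff_nonempty.mpr b.index_nonempty)]

end ULift

theorem mem_smul_top_of_forall_mem {R : Type u} [CommRing R] {M : Type v} [AddCommGroup M]
    [Module R M] {I : Ideal R} {K : Type w} [AddCommGroup K] [Module R K]
    [Module.Free R K] [Module.Finite R K] {φ : K →ₗ[R] M}
    (hφ : ∀ x, φ x ∈ I • (⊤ : Submodule R M)) :
    φ ∈ I • (⊤ : Submodule R (K →ₗ[R] M)) := by
  let b := Module.Free.chooseBasis R K
  have : φ = ∑ i, LinearMap.smulRightₗ (b.coord i) (φ (b i)) := by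
    refine b.ext fun j => ?_
    simp [LinearMap.sum_apply, Finsupp.single_apply]
  rw [this]
  refine sum_mem fun i _ => ?_
  have := Submodule.mem_map_of_mem (f := LinearMap.smulRightₗ (b.coord i)) (hφ (b i))
  rw [Submodule.map_smul''] at this
  exact Submodule.smul_mono le_rfl le_top this

/-! ### Minimal covers and finite free resolutions -/

section MinimalCover

open IsLocalRing

variable (R : Type u) [CommRing R] [IsLocalRing R] (M : Type v) [AddCommGroup M] [Module R M]

/-- Lift a basis of `k ⊗ M`, with `k` the residue field: the lifts generate by Nakayama, and any
relation reduces to a relation between basis vectors, so its coefficients lie in `𝔪`. -/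
theorem exists_minimal_cover [Module.Finite R M] :
    ∃ (r : ℕ) (π : (Fin r → R) →ₗ[R] M), Function.Surjective π ∧
      ∀ x, π x = 0 → x ∈ maximalIdeal R • (⊤ : Submodule R (Fin r → R)) := by
  let b := Module.finBasis (ResidueField R) (ResidueField R ⊗[R] M)
  have hsurj : ∀ i, ∃ m : M, (1 : ResidueField R) ⊗ₜ[R] m = b i := fun i =>
    TensorProduct.mk_surjective R M (ResidueField R) Ideal.Quotient.mk_surjective (b i)
  choose m hm using hsurj
  refine ⟨_, Fintype.linearCombination R m, ?_, fun x hx => ?_⟩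
  · rw [← LinearMap.range_eq_top, Fintype.range_linearCombination]
    exact span_eq_top_of_tmul_eq_basis m b hm
  · have hmem : ∀ i, x i ∈ maximalIdeal R := by
      have h₀ : ∑ i, residue R (x i) • b i = 0 := by
        have := congrArg (TensorProduct.mk R (ResidueField R) M 1) hx
        rw [Fintype.linearCombination_apply, map_sum, map_zero] at this
        rw [← this]
        refine Finset.sum_congr rfl fun i _ => ?_
        rw [map_smul, TensorProduct.mk_apply, hm, ← algebraMap_smul (ResidueField R) (x i)]
        rfl
      intro i
      rw [← residue_eq_zero_iff]
      exact Fintype.linearIndependent_iff.mp b.linearIndependent _ h₀ i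
    have : x = ∑ i, x i • Pi.single i (1 : R) := by
      ext j
      simp [Finset.sum_apply, Pi.single_apply]
    rw [this]
    exact sum_mem fun i _ => Submodule.smul_mem_smul (hmem i) trivial

end MinimalCover

section FreeResolution

variable {R : Type u} [CommRing R] {M : Type v} [AddCommGroup M] [Module R M]

theorem IsFP.finite {n : ℕ} (h : IsFP R M n) : Module.Finite R M := by
  obtain ⟨r, d, ε, hε, -⟩ := h
  exact .of_surjective ε hε

theorem IsFP.finitePresentation {n : ℕ} (h : IsFP R M (n + 1)) : Module.FinitePresentation R M := by
  obtain ⟨r, d, ε, hε, hex, -⟩ := h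
  refine Module.finitePresentation_of_free_of_surjective ε hε ?_
  rw [(hex n.succ_pos).linearMap_ker_eq]
  exact Submodule.fg_range (d 0)

variable [Small.{v} R]

/-- A module with a free resolution of length `n + 1` is a quotient of a finite free module by a
submodule with a free resolution of length `n`. -/
theorem IsFP.exists_syzygy {n : ℕ} (h : IsFP R M (n + 1)) :
    ∃ (F : Type v) (_ : AddCommGroup F) (_ : Module R F) (π : F →ₗ[R] M),
      Module.Free R F ∧ Module.Finite R F ∧ Function.Surjective π ∧
        IsFP R (LinearMap.ker π) n := by
  obtain ⟨r, d, ε, hε, hex, hd⟩ := h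
  let e := Shrink.linearEquiv.{v} R (Fin (r 0) → R)
  have hex₀ := hex n.succ_pos
  have hcod : ∀ x, (e.symm.toLinearMap ∘ₗ d 0) x ∈ LinearMap.ker (ε ∘ₗ e.toLinearMap) := by
    intro x
    simp [hex₀.apply_apply_eq_zero]
  refine ⟨Shrink.{v} (Fin (r 0) → R), inferInstance, inferInstance, ε ∘ₗ e.toLinearMap,
    .of_equiv e.symm, .equiv e.symm, hε.comp e.surjective, fun i => r (i + 1),
    fun i => d (i + 1), (e.symm.toLinearMap ∘ₗ d 0).codRestrict _ hcod, ?_, ?_, ?_⟩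
  · rintro ⟨y, hy⟩
    obtain ⟨x, hx⟩ := (hex₀ (e y)).mp hy
    exact ⟨x, Subtype.ext (by simp [hx])⟩
  · intro hn x
    have : (e.symm.toLinearMap ∘ₗ d 0).codRestrict _ hcod x = 0 ↔ d 0 x = 0 := by
      rw [← Subtype.coe_inj]
      simp
    exact this.trans (hd 0 (by omega) x)
  · exact fun i hi => hd (i + 1) (by omega)

theorem exists_minimal_cover_of_small (R : Type u) [CommRing R] [IsLocalRing R] (M : Type v)
    [AddCommGroup M] [Module R M] [Small.{v} R] [Module.Finite R M] :
    ∃ (F : Type v) (_ : AddCommGroup F) (_ : Module R F) (π : F →ₗ[R] M),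
      Module.Free R F ∧ Module.Finite R F ∧ Function.Surjective π ∧
        ∀ x, π x = 0 → x ∈ IsLocalRing.maximalIdeal R • (⊤ : Submodule R F) := by
  obtain ⟨r, π, hπ, hker⟩ := exists_minimal_cover R M
  let e := Shrink.linearEquiv.{v} R (Fin r → R)
  refine ⟨Shrink.{v} (Fin r → R), inferInstance, inferInstance, π ∘ₗ e.toLinearMap,
    .of_equiv e.symm, .equiv e.symm, hπ.comp e.surjective, fun x hx => ?_⟩
  have := Submodule.mem_map_of_mem (f := e.symm.toLinearMap) (hker (e x) hx)
  rw [Submodule.map_smul''] at this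
  simpa using Submodule.smul_mono le_rfl le_top this

end FreeResolution

/-! ### The Auslander–Buchsbaum formula -/

section AuslanderBuchsbaum

open CategoryTheory IsLocalRing

variable {R : Type u} [CommRing R]

theorem hasProjectiveDimensionLT_ker_iff [Small.{v} R] {F M : Type v} [AddCommGroup F]
    [AddCommGroup M] [Module R F] [Module R M] [Module.Projective R F] {π : F →ₗ[R] M}
    (hπ : Function.Surjective π) (n : ℕ) :
    HasProjectiveDimensionLT (ModuleCat.of R M) (n + 2) ↔
      HasProjectiveDimensionLT (ModuleCat.of R (LinearMap.ker π)) (n + 1) :=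
  (LinearMap.shortExact_shortComplexKer hπ).hasProjectiveDimensionLT_X₃_iff n
    ((IsProjective.iff_projective F).mp inferInstance)

theorem projective_iff_hasProjectiveDimensionLT_one [Small.{v} R] (M : Type v) [AddCommGroup M]
    [Module R M] :
    Module.Projective R M ↔ HasProjectiveDimensionLT (ModuleCat.of R M) 1 :=
  (IsProjective.iff_projective M).trans CategoryTheory.projective_iff_hasProjectiveDimensionLT_one

/-- The Auslander–Buchsbaum formula with respect to every sufficiently large finitely generated
ideal. -/
theorem exists_forall_polyDepthGE_iff [IsLocalRing R] [Small.{v} R] (n : ℕ) :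
    ∀ (M : Type v) [AddCommGroup M] [Module R M] [Nontrivial M], IsFP R M (n + 1) →
      HasProjectiveDimensionLT (ModuleCat.of R M) (n + 1) →
      ¬ HasProjectiveDimensionLT (ModuleCat.of R M) n →
      ∃ g : R[X], g.contentIdeal ≤ maximalIdeal R ∧
        ∀ f : R[X], g.contentIdeal ≤ f.contentIdeal → ∀ k,
          PolyDepthGE.{u, v} f k (ULift.{u} M) ↔ PolyDepthGE.{u, v} f (k + n) (ULift.{v} R) := by
  induction n with
  | zero =>
    intro M _ _ _ hM hpd _
    have := hM.finite
    have : Module.Projective R M := (projective_iff_hasProjectiveDimensionLT_one M).mpr hpd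
    have : Module.Free R M := Module.free_of_flat_of_isLocalRing
    exact ⟨0, by simp, fun f _ k => polyDepthGE_ulift_iff_of_free k⟩
  | succ n ih =>
    intro M _ _ _ hM hpd hpd'
    cases n with
    | zero =>
      have := hM.finite
      have := hM.finitePresentation
      obtain ⟨F, _, _, π, _, _, hπ, hker⟩ := exists_minimal_cover_of_small R M
      have : Module.Finite R (LinearMap.ker π) :=
        .of_fg (Module.FinitePresentation.fg_ker π hπ)
      have : Module.Projective R (LinearMap.ker π) :=
        (projective_iff_hasProjectiveDimensionLT_one _).mpr
          ((hasProjectiveDimensionLT_ker_iff hπ 0).mp hpd)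
      have : Module.Free R (LinearMap.ker π) := Module.free_of_flat_of_isLocalRing
      have : Nontrivial F := hπ.nontrivial
      have : Nontrivial (LinearMap.ker π) := by
        rw [Submodule.nontrivial_iff_ne_bot]
        -- A zero kernel would make `M` free, against projective dimension 1.
        intro h
        refine hpd' ((projective_iff_hasProjectiveDimensionLT_one M).mp ?_)
        exact .of_equiv' (LinearEquiv.ofBijective π ⟨LinearMap.ker_eq_bot.mp h, hπ⟩)
      -- The kernel is finite free, so its inclusion into `F` involves finitely many elements of
      -- `𝔪`; they determine `g`.
      obtain ⟨g, hg, hmem⟩ := exists_mem_contentIdeal_smul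
        (mem_smul_top_of_forall_mem (φ := (LinearMap.ker π).subtype) fun x => hker x x.2)
      refine ⟨g, hg, fun f hf k => ?_⟩
      exact PolyDepthGE.iff_of_exact_of_mem_smul
        (uliftMap_injective (LinearMap.ker π).injective_subtype)
        (uliftMap_exact π.exact_subtype_ker_map) (uliftMap_surjective hπ)
        (uliftMap_mem_smul (Submodule.smul_mono hf le_rfl hmem))
        (fun k => (polyDepthGE_ulift_iff_of_free k).mpr) polyDepthGE_ulift_iff_of_free k
    | succ n =>
      obtain ⟨F, _, _, π, _, _, hπ, hK⟩ := hM.exists_syzygy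
      have : Nontrivial F := hπ.nontrivial
      rw [hasProjectiveDimensionLT_ker_iff hπ] at hpd hpd'
      have : Nontrivial (LinearMap.ker π) := by
        rw [← not_subsingleton_iff_nontrivial]
        intro h
        refine hpd' ?_
        have := (ModuleCat.isZero_of_subsingleton
          (ModuleCat.of R (LinearMap.ker π))).hasProjectiveDimensionLT_zero
        exact hasProjectiveDimensionLT_of_ge _ 0 _ (Nat.zero_le _)
      obtain ⟨g, hg, h⟩ := ih (LinearMap.ker π) hK hpd hpd'
      refine ⟨g, hg, fun f hf k => ?_⟩
      exact PolyDepthGE.iff_of_exact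
        (uliftMap_injective (LinearMap.ker π).injective_subtype)
        (uliftMap_exact π.exact_subtype_ker_map) (uliftMap_surjective hπ) n
        (fun k => (polyDepthGE_ulift_iff_of_free k).mpr) (h f hf) k

theorem depth_add_eq [IsLocalRing R] [Small.{v} R] (M : Type v) [AddCommGroup M] [Module R M]
    [Nontrivial M] {n : ℕ} (hM : IsFP R M (n + 1))
    (hpd : HasProjectiveDimensionLT (ModuleCat.of R M) (n + 1))
    (hpd' : ¬ HasProjectiveDimensionLT (ModuleCat.of R M) n) :
    depth R M + n = depth R R := by
  have := hM.finite
  obtain ⟨g, hg, h⟩ := exists_forall_polyDepthGE_iff n M hM hpd hpd'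
  have eR : ∀ (f : R[X]) (k : ℕ), PolyDepthGE.{u, v} f k (ULift.{v} R) ↔
      PolyDepthGE.{u, u} f k (ULift.{u} R) := fun f k =>
    PolyDepthGE.congr.{u, v, u} (ULift.moduleEquiv ≪≫ₗ ULift.moduleEquiv.symm)
  have key : ∀ k : ℕ, (k : ℕ∞) ≤ depth R M ↔ ((k + n : ℕ) : ℕ∞) ≤ depth R R := by
    intro k
    rw [le_depth_iff, le_depth_iff]
    constructor
    · rintro ⟨f, hf, hk⟩
      -- Enlarging the ideal to contain that of `g` keeps the bound and makes `h` applicable.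
      obtain ⟨p, hp⟩ := exists_contentIdeal_eq_sup f g
      refine ⟨p, hp ▸ sup_le hf hg, ?_⟩
      rw [← eR, ← h p (hp ▸ le_sup_right)]
      exact hk.of_contentIdeal_le (hp ▸ le_sup_left)
    · rintro ⟨f, hf, hk⟩
      obtain ⟨p, hp⟩ := exists_contentIdeal_eq_sup f g
      refine ⟨p, hp ▸ sup_le hf hg, ?_⟩
      rw [h p (hp ▸ le_sup_right), eR]
      exact hk.of_contentIdeal_le (hp ▸ le_sup_left)
  refine ENat.eq_of_forall_natCast_le_iff fun m => ?_
  rcases le_or_gt n m with hnm | hnm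
  · obtain ⟨k, rfl⟩ := Nat.exists_eq_add_of_le' hnm
    rw [← key, Nat.cast_add]
    exact ENat.add_le_add_iff_right (ENat.natCast_ne_top n)
  -- For `m < n` both inequalities hold, since `key 0` gives `n ≤ depth R R`.
  · have h₁ : (m : ℕ∞) ≤ n := by exact_mod_cast hnm.le
    have h₂ : (n : ℕ∞) ≤ depth R R := by simpa using (key 0).mp (by simp)
    exact ⟨fun _ => h₁.trans h₂, fun _ => h₁.trans le_add_self⟩

end AuslanderBuchsbaum

end NonNoetherian

/-- The projective dimension is an element of `{-∞} ∪ ℕ ∪ {∞}`, and the equality is read there.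
`Small.{v} R` says only that the universe of `M` is not too small to contain the free `R`-modules;
it holds automatically for modules in the universe of `R` or a larger one. -/
theorem corollary4p6 (R : Type u) [CommRing R] [IsLocalRing R]
    (M : Type v) [AddCommGroup M] [Module R M] [Small.{v} R] [Nontrivial M]
    (hM : NonNoetherian.IsFPInfinity R M)
    (hpd : CategoryTheory.projectiveDimension (ModuleCat.of R M) ≠ ⊤) :
    (NonNoetherian.depth R M : WithBot ℕ∞) +
        CategoryTheory.projectiveDimension (ModuleCat.of R M) =
      (NonNoetherian.depth R R : WithBot ℕ∞) := by
  obtain ⟨n, hn⟩ : ∃ n : ℕ, CategoryTheory.projectiveDimension (ModuleCat.of R M) = n := by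
    have hbot : CategoryTheory.projectiveDimension (ModuleCat.of R M) ≠ ⊥ := by
      rw [ne_eq, CategoryTheory.projectiveDimension_eq_bot_iff,
        ModuleCat.isZero_iff_subsingleton, not_subsingleton_iff_nontrivial]
      infer_instance
    generalize CategoryTheory.projectiveDimension (ModuleCat.of R M) = d at hpd hbot
    induction d with
    | bot => exact absurd rfl hbot
    | coe d =>
      induction d with
      | top => exact absurd rfl hpd
      | coe n => exact ⟨n, rfl⟩
  rw [hn, ← NonNoetherian.depth_add_eq M (hM (n + 1))
    ((CategoryTheory.projectiveDimension_le_iff _ n).mp hn.le)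
    ((CategoryTheory.projectiveDimension_ge_iff _ n).mp hn.ge)]
  rfl
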